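/- Let $p\in\{0,2,3,4,\dots\}\cup\{\infty\}$, and let $\mathrm{Diff}^p(S^1)$ denote the group of all $C^p$ diffeomorphisms of the circle $S^1$ under composition (for $p=0$, the group of homeomorphisms of $S^1$). Let $\iota\colon \mathrm{PSL}(2,\mathbb{R})\to \mathrm{Diff}^p(S^1)$ be the standard inclusion, that is, the projective action of $\mathrm{PSL}(2,\mathbb{R})$ on the space of lines through the origin of $\mathbb{R}^2=\mathbb{C}$, which is identified with the unit circle $S^1\subset\mathbb{C}$ by sending the line $\mathbb{R}v$ ($v\neq0$) to $v/\bar v$. Then for every nontrivial homomorphism of abstract groups $\Phi\colon \mathrm{PSL}(2,\mathbb{R})\to \mathrm{Diff}^p(S^1)$ there is a $C^p$ diffeomorphism $h$ of $S^1$ (a homeomorphism if $p=0$) such that $\Phi(g)=h\circ\iota(g)\circ h^{-1}$ for all $g\in \mathrm{PSL}(2,\mathbb{R})$. -/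

import Mathlib

open scoped Manifold ContDiff MatrixGroups ComplexConjugate

noncomputable section

namespace CircleDiff

/-- `Diff^p(S¹)`, `p ∈ {0, 1, 2, …, ∞}`: the `C^p` diffeomorphisms of the unit circle (orientation
preserving or not); for `p = 0` these are the homeomorphisms. -/
abbrev Diff (p : ℕ∞) : Type := Diffeomorph (𝓡 1) (𝓡 1) Circle Circle (p : ℕ∞ω)

/-- `Diff^p(S¹)` is a group under composition, `(f * g) x = f (g x)`. -/
instance instGroupDiff (p : ℕ∞) : Group (Diff p) where
  mul f g := Diffeomorph.trans g f
  one := Diffeomorph.refl (𝓡 1) Circle (p : ℕ∞ω)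
  inv f := f.symm
  mul_assoc _ _ _ := rfl
  one_mul _ := rfl
  mul_one _ := rfl
  inv_mul_cancel f := Diffeomorph.self_trans_symm f

theorem Diff.mul_apply {p : ℕ∞} (f g : Diff p) (x : Circle) : (f * g) x = f (g x) := rfl

theorem Diff.one_apply {p : ℕ∞} (x : Circle) : (1 : Diff p) x = x := rfl

/-- For `g = (a b; c d) ∈ SL(2,ℝ)`, acting on `ℂ = ℝ²` by real linear maps, `g v = α v + β v̄` where
`α = ((a + d) + (c - b) i) / 2` and `β = ((a - d) + (c + b) i) / 2`. This is `α`. -/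
def alpha (g : SL(2, ℝ)) : ℂ := ⟨(g 0 0 + g 1 1) / 2, (g 1 0 - g 0 1) / 2⟩

/-- The coefficient `β` of `v̄` in `g v = α v + β v̄`. -/
def beta (g : SL(2, ℝ)) : ℂ := ⟨(g 0 0 - g 1 1) / 2, (g 1 0 + g 0 1) / 2⟩

theorem alpha_mul_conj_sub (g : SL(2, ℝ)) :
    alpha g * conj (alpha g) - beta g * conj (beta g) = 1 := by
  have h := g.det_coe
  rw [Matrix.det_fin_two] at h
  apply Complex.ext
  · simp [alpha, beta]; linear_combination h
  · simp [alpha, beta]; ring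

theorem coe_mul_conj (z : Circle) : (z : ℂ) * conj (z : ℂ) = 1 := by
  rw [Complex.mul_conj, Circle.normSq_coe]; simp

theorem denom_ne_zero (g : SL(2, ℝ)) (z : Circle) :
    conj (beta g) * (z : ℂ) + conj (alpha g) ≠ 0 := by
  intro h
  have h1 := alpha_mul_conj_sub g
  have h2 := coe_mul_conj z
  have h3 := congrArg conj h
  simp only [map_add, map_mul, Complex.conj_conj, map_zero] at h3
  have : (1 : ℂ) = 0 := by
    linear_combination (-1 : ℂ) * h1 + alpha g * h - conj (beta g) * (z : ℂ) * h3
      + beta g * conj (beta g) * h2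
  exact one_ne_zero this

theorem norm_moebius (g : SL(2, ℝ)) (z : Circle) :
    ‖(alpha g * (z : ℂ) + beta g) / (conj (beta g) * (z : ℂ) + conj (alpha g))‖ = 1 := by
  have hn : alpha g * (z : ℂ) + beta g
      = (z : ℂ) * conj (conj (beta g) * (z : ℂ) + conj (alpha g)) := by
    have h2 := coe_mul_conj z
    simp only [map_add, map_mul, Complex.conj_conj]
    linear_combination (-beta g) * h2
  rw [hn, norm_div, norm_mul, Circle.norm_coe, one_mul, RCLike.norm_conj]
  exact div_self (norm_ne_zero_iff.mpr (denom_ne_zero g z))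

/-- The projective action of `SL(2,ℝ)` on the circle: identifying the real line spanned by `v ≠ 0`
in `ℝ² = ℂ` with the point `v / v̄` of the unit circle, the line `ℝ v` goes to `ℝ (g v)`.
In the coordinate `z = v / v̄` this is the Möbius transformation `z ↦ (α z + β) / (β̄ z + ᾱ)`. -/
def moebius (g : SL(2, ℝ)) (z : Circle) : Circle :=
  ⟨(alpha g * (z : ℂ) + beta g) / (conj (beta g) * (z : ℂ) + conj (alpha g)),
    mem_sphere_zero_iff_norm.mpr (norm_moebius g z)⟩

theorem coe_moebius (g : SL(2, ℝ)) (z : Circle) : (moebius g z : ℂ) =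
    (alpha g * (z : ℂ) + beta g) / (conj (beta g) * (z : ℂ) + conj (alpha g)) := rfl

/-- The defining property of the projective action: with `v / v̄` the point of the circle that
represents the line spanned by `v = x + i y`, the matrix `(a b; c d)` moves it to the point that
represents the line spanned by `(a x + b y) + i (c x + d y)`. -/
theorem moebius_line (g : SL(2, ℝ)) (x y : ℝ) (z : Circle) (hv : (⟨x, y⟩ : ℂ) ≠ 0)
    (hz : (z : ℂ) = (⟨x, y⟩ : ℂ) / conj (⟨x, y⟩ : ℂ)) :
    (moebius g z : ℂ) = (⟨g 0 0 * x + g 0 1 * y, g 1 0 * x + g 1 1 * y⟩ : ℂ) /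
      conj (⟨g 0 0 * x + g 0 1 * y, g 1 0 * x + g 1 1 * y⟩ : ℂ) := by
  have hgv : (⟨g 0 0 * x + g 0 1 * y, g 1 0 * x + g 1 1 * y⟩ : ℂ)
      = alpha g * (⟨x, y⟩ : ℂ) + beta g * conj (⟨x, y⟩ : ℂ) := by
    apply Complex.ext <;> (simp [alpha, beta]; ring)
  rw [coe_moebius, hgv, hz]
  set v : ℂ := ⟨x, y⟩
  have hv' : conj v ≠ 0 := (map_ne_zero _).mpr hv
  simp only [map_add, map_mul, Complex.conj_conj]
  rw [← mul_div_mul_right _ _ hv']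
  congr 1 <;> field_simp
  ring

theorem alpha_mul (g h : SL(2, ℝ)) :
    alpha (g * h) = alpha g * alpha h + beta g * conj (beta h) := by
  apply Complex.ext <;> simp [alpha, beta, Matrix.mul_apply, Fin.sum_univ_two] <;> ring

theorem beta_mul (g h : SL(2, ℝ)) :
    beta (g * h) = alpha g * beta h + beta g * conj (alpha h) := by
  apply Complex.ext <;> simp [alpha, beta, Matrix.mul_apply, Fin.sum_univ_two] <;> ring

theorem moebius_one (z : Circle) : moebius 1 z = z := by
  have ha : alpha 1 = 1 := by apply Complex.ext <;> simp [alpha]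
  have hb : beta 1 = 0 := by apply Complex.ext <;> simp [beta]
  apply Circle.ext
  simp [coe_moebius, ha, hb]

theorem moebius_mul (g h : SL(2, ℝ)) (z : Circle) :
    moebius (g * h) z = moebius g (moebius h z) := by
  apply Circle.ext
  have h1 := denom_ne_zero h z
  have h2 := denom_ne_zero g (moebius h z)
  have h3 := denom_ne_zero (g * h) z
  rw [coe_moebius] at h2
  rw [coe_moebius, coe_moebius, coe_moebius, div_eq_div_iff h3 h2]
  simp only [alpha_mul, beta_mul, map_add, map_mul, Complex.conj_conj]
  field_simp
  ring

attribute [local instance] finrank_real_complex_fact'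

theorem contMDiff_moebius (g : SL(2, ℝ)) (n : ℕ∞ω) :
    ContMDiff (𝓡 1) (𝓡 1) n (moebius g) := by
  have hc : ContMDiff (𝓡 1) 𝓘(ℝ, ℂ) n (fun z : Circle => (z : ℂ)) := contMDiff_coe_sphere
  have hf : ContMDiff (𝓡 1) 𝓘(ℝ, ℂ) n (fun z : Circle =>
      (alpha g * (z : ℂ) + beta g) / (conj (beta g) * (z : ℂ) + conj (alpha g))) := by
    intro z
    have hd : ContDiffAt ℂ n (fun w : ℂ =>
        (alpha g * w + beta g) / (conj (beta g) * w + conj (alpha g))) (z : ℂ) :=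
      ContDiffAt.div ((contDiffAt_const.mul contDiffAt_id).add contDiffAt_const)
        ((contDiffAt_const.mul contDiffAt_id).add contDiffAt_const) (denom_ne_zero g z)
    exact ContMDiffAt.comp z (hd.restrict_scalars ℝ).contMDiffAt (hc z)
  exact ContMDiff.codRestrict_sphere hf (fun z => mem_sphere_zero_iff_norm.mpr (norm_moebius g z))

/-- The projective action of a matrix as an element of `Diff^p(S¹)`. -/
def moebiusDiff (p : ℕ∞) (g : SL(2, ℝ)) : Diff p where
  toFun := moebius g
  invFun := moebius g⁻¹
  left_inv z := by rw [← moebius_mul, inv_mul_cancel, moebius_one]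
  right_inv z := by rw [← moebius_mul, mul_inv_cancel, moebius_one]
  contMDiff_toFun := contMDiff_moebius g _
  contMDiff_invFun := contMDiff_moebius g⁻¹ _

/-- The homomorphism `SL(2,ℝ) → Diff^p(S¹)` given by the projective action. -/
def moebiusHom (p : ℕ∞) : SL(2, ℝ) →* Diff p where
  toFun := moebiusDiff p
  map_one' := Diffeomorph.ext moebius_one
  map_mul' g h := Diffeomorph.ext (moebius_mul g h)

theorem center_le_ker (p : ℕ∞) : Subgroup.center SL(2, ℝ) ≤ (moebiusHom p).ker := by
  intro g hg
  obtain ⟨r, -, hr⟩ := Matrix.SpecialLinearGroup.mem_center_iff.mp hg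
  have e : ∀ i j, g i j = Matrix.scalar (Fin 2) r i j := fun i j => by rw [hr]
  have hb : beta g = 0 := by apply Complex.ext <;> simp [beta, e]
  have ha : conj (alpha g) = alpha g := by
    apply Complex.ext <;> simp [alpha, e]
  rw [MonoidHom.mem_ker]
  refine Diffeomorph.ext fun z => Circle.ext ?_
  change (moebius g z : ℂ) = z
  have h0 := denom_ne_zero g z
  simp only [hb, ha, map_zero, zero_mul, zero_add] at h0
  simp only [coe_moebius, hb, ha, map_zero, zero_mul, zero_add, add_zero]
  exact mul_div_cancel_left₀ _ h0

/-- The standard inclusion `PSL(2,ℝ) → Diff^p(S¹)`. -/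
def standardInclusion (p : ℕ∞) : PSL(2, ℝ) →* Diff p :=
  QuotientGroup.lift (Subgroup.center SL(2, ℝ)) (moebiusHom p) (center_le_ker p)

theorem standardInclusion_mk (p : ℕ∞) (g : SL(2, ℝ)) (z : Circle) :
    standardInclusion p (g : PSL(2, ℝ)) z = moebius g z := rfl

end CircleDiff

end

/-!
Write `G = PSL(2,ℝ)` and let `B ⊂ G` be the upper triangular subgroup, the stabiliser of the point
`1` of the circle, with its unipotent subgroup `N` and diagonal subgroup `A`.

*Fixed points.* Elements of `N` and `A` are squares, so they act by orientation preserving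
homeomorphisms. Each unipotent element is conjugate to its own square, and each diagonal element is
the square of an element conjugate to its inverse; translation numbers of lifts then show that all
of them act with fixed points (`exists_fixed_of_conj_sq`, `exists_fixed_of_conj_inv`). Commuting
orientation preserving homeomorphisms with fixed points have a common one in every invariant closed
set (`exists_common_fixed_mem`), so `N` has a fixed point, and `A` has one in the fixed point
set of `N`: the whole of `B` fixes a point `z₀`.

*The orbit map.* By the Bruhat decomposition `B` is a maximal subgroup, and `G` itself does not fix
`z₀`, because the involution `w = (0 -1; 1 0)` would then act trivially. Hence `g • 1 ↦ Φ g z₀` is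
an injective equivariant map `j` of circles (`exists_orbitMap`). In the affine chart it is an
injection `J : ℝ → ℝ` on which the affine group, transitive on pairs `x < y`, acts by increasing
maps, so `J` is monotone or antitone; it has a point of continuity, so by equivariance it is
continuous, and the image of `j` is open and closed. Thus `j` is a homeomorphism which conjugates
the two actions (`exists_topological_conjugacy`).

*Regularity.* It remains to see that a homeomorphism `j` which conjugates all rotations to `Cᵖ`
diffeomorphisms is itself a `Cᵖ` diffeomorphism. For a lift `J`, put `F θ y = J (J⁻¹ y + θ)`. By the
Baire category theorem `F θ` is uniformly Lipschitz for `θ` in some interval, over which one can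
integrate: `G y = ∫ F θ y dθ` is `C¹` and `G (J s) = ∫ J (s + θ) dθ` is a `C¹` function of `s`, whence
`J` is `C¹` (`contDiff_one_conj`). Then `log J' (t + θ) - log J' t = log ((F θ)' (J t))` has one more
derivative than `J'` is known to have, for every `θ`, and a periodic continuous function all of
whose differences are `Cᵏ` is `Cᵏ` (`contDiff_of_differences`), again by the Baire category theorem;
induction gives `Cᵖ` (`contDiff_conj`).
-/

noncomputable section

namespace CircleDiff

open Function Set Filter Topology

/-! ### Lifts of circle maps to the real line -/

/-- The universal covering `t ↦ exp (2πit)` of the circle, normalised to have period `1`. -/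
def circ (t : ℝ) : Circle := Circle.exp (2 * Real.pi * t)

theorem continuous_circ : Continuous circ :=
  Circle.exp.continuous.comp (continuous_const.mul continuous_id)

theorem circ_add (s t : ℝ) : circ (s + t) = circ s * circ t := by
  rw [circ, mul_add, Circle.exp_add]; rfl

theorem circ_eq_iff {s t : ℝ} : circ s = circ t ↔ ∃ n : ℤ, s = t + n := by
  rw [circ, circ, Circle.exp_eq_exp]
  have hpi := Real.two_pi_pos.ne'
  refine exists_congr fun n => ⟨fun h => mul_left_cancel₀ hpi ?_, fun h => ?_⟩
  · linear_combination h
  · rw [h]; ring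

theorem circ_add_int (t : ℝ) (n : ℤ) : circ (t + n) = circ t := circ_eq_iff.2 ⟨n, rfl⟩

theorem circ_zero : circ 0 = 1 := by simp [circ]

theorem circ_surjective : Surjective circ := fun z => by
  obtain ⟨t, rfl⟩ := Circle.exp_surjective z
  exact ⟨t / (2 * Real.pi), by rw [circ, mul_div_cancel₀ _ Real.two_pi_pos.ne']⟩

theorem isOpenMap_circ : IsOpenMap circ :=
  Circle.isCoveringMap_exp.isLocalHomeomorph.isOpenMap.comp
    (Homeomorph.mulLeft₀ (2 * Real.pi) Real.two_pi_pos.ne').isOpenMap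

/-- `F` is a continuous lift to the line of the circle map `f`. -/
structure IsLift (F : ℝ → ℝ) (f : Circle → Circle) : Prop where
  continuous : Continuous F
  circ_apply : ∀ t, circ (F t) = f (circ t)

namespace IsLift

variable {F G : ℝ → ℝ} {f g : Circle → Circle}

theorem comp (hF : IsLift F f) (hG : IsLift G g) : IsLift (F ∘ G) (f ∘ g) :=
  ⟨hF.continuous.comp hG.continuous, fun t => by simp [hF.circ_apply, hG.circ_apply]⟩

theorem add_int (hF : IsLift F f) (n : ℤ) : IsLift (fun t => F t + n) f :=
  ⟨hF.continuous.add continuous_const, fun t => by rw [circ_add_int, hF.circ_apply]⟩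

theorem eq_of_eq (hF : IsLift F f) (hG : IsLift G f) {t₀ : ℝ} (h : F t₀ = G t₀) : F = G := by
  have hpi := Real.two_pi_pos.ne'
  have key := Circle.isCoveringMap_exp.eq_of_comp_eq
    (g₁ := fun t => 2 * Real.pi * F t) (g₂ := fun t => 2 * Real.pi * G t)
    (continuous_const.mul hF.continuous) (continuous_const.mul hG.continuous)
    (funext fun t => (hF.circ_apply t).trans (hG.circ_apply t).symm) t₀ (by simp only [h])
  exact funext fun t => mul_left_cancel₀ hpi (congrFun key t)

/-- Two lifts of the same map differ by an integer translation. -/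
theorem exists_eq_add_int (hF : IsLift F f) (hG : IsLift G f) : ∃ n : ℤ, ∀ t, F t = G t + n := by
  obtain ⟨n, hn⟩ := circ_eq_iff.1 ((hF.circ_apply 0).trans (hG.circ_apply 0).symm)
  exact ⟨n, congrFun (hF.eq_of_eq (hG.add_int n) hn)⟩

theorem id : IsLift (fun t => t) (fun z => z) := ⟨continuous_id, fun _ => rfl⟩

/-- The integer `d` is the degree of the circle map `f`. -/
theorem exists_degree (hF : IsLift F f) : ∃ d : ℤ, ∀ t, F (t + 1) = F t + d := by
  have h1 : IsLift (fun t => F (t + 1)) f :=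
    ⟨hF.continuous.comp (continuous_id.add continuous_const), fun t => by
      rw [hF.circ_apply]; exact congrArg f (by simpa using circ_add_int t 1)⟩
  exact h1.exists_eq_add_int hF

theorem apply_add_int {d : ℤ} (hd : ∀ t, F (t + 1) = F t + d) (t : ℝ) (n : ℤ) :
    F (t + n) = F t + n * d := by
  induction n with
  | zero => simp
  | succ k ih =>
    push_cast at ih ⊢
    rw [← add_assoc, hd, ih]; ring
  | pred k ih =>
    have := hd (t + ((-k - 1 : ℤ) : ℝ))
    push_cast at ih this ⊢
    rw [show t + (-(k:ℝ) - 1) + 1 = t + -(k:ℝ) by ring, ih] at this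
    linear_combination -this

end IsLift

theorem exists_isLift {f : Circle → Circle} (hf : Continuous f) : ∃ F, IsLift F f := by
  obtain ⟨s, hs⟩ := Circle.exp_surjective (f (circ 0))
  obtain ⟨F, ⟨-, hF⟩, -⟩ := Circle.isCoveringMap_exp.existsUnique_continuousMap_lifts
    ⟨f ∘ circ, hf.comp continuous_circ⟩ 0 s hs
  have hpi := Real.two_pi_pos.ne'
  refine ⟨fun t => F t / (2 * Real.pi), F.continuous.div_const _, fun t => ?_⟩
  rw [circ, mul_div_cancel₀ _ hpi]
  exact congrFun hF t

/-- A lift of a homeomorphism of the circle is injective and of degree `±1`. -/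
theorem IsLift.injective_and_degree {f : Circle ≃ₜ Circle} {F : ℝ → ℝ} (hF : IsLift F f) :
    Injective F ∧ ((∀ t, F (t + 1) = F t + 1) ∨ ∀ t, F (t + 1) = F t - 1) := by
  obtain ⟨G, hG⟩ := exists_isLift f.symm.continuous
  have hGF : IsLift (G ∘ F) (fun z => z) := by
    have := hG.comp hF
    rwa [show (f.symm : Circle → Circle) ∘ f = fun z => z from funext fun z => f.symm_apply_apply z]
      at this
  obtain ⟨n, hn⟩ := hGF.exists_eq_add_int IsLift.id
  simp only [comp_apply] at hn
  refine ⟨fun s t h => ?_, ?_⟩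
  · have := hn s
    rw [h, hn t] at this
    linarith
  · obtain ⟨d, hd⟩ := hF.exists_degree
    obtain ⟨e, he⟩ := hG.exists_degree
    have h1 := hn (0 + 1)
    rw [hd, IsLift.apply_add_int he, hn] at h1
    have h2 : d * e = 1 := by
      have : (d : ℝ) * e = 1 := by linarith
      exact_mod_cast this
    rcases Int.isUnit_iff.1 (IsUnit.of_mul_eq_one _ h2) with rfl | rfl
    · left; simpa using hd
    · right; intro t; simpa [sub_eq_add_neg] using hd t

theorem IsLift.strictMono_or_strictAnti {f : Circle ≃ₜ Circle} {F : ℝ → ℝ} (hF : IsLift F f) :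
    (StrictMono F ∧ ∀ t, F (t + 1) = F t + 1) ∨ (StrictAnti F ∧ ∀ t, F (t + 1) = F t - 1) := by
  obtain ⟨hi, hd⟩ := hF.injective_and_degree
  have h01 := hd.imp (fun h => h 0) (fun h => h 0)
  rcases hF.continuous.strictMono_of_inj hi with hm | hm
  · have := hm (show (0 : ℝ) < 0 + 1 by norm_num)
    rcases hd with hd | hd
    · exact .inl ⟨hm, hd⟩
    · have := hd 0; linarith
  · have := hm (show (0 : ℝ) < 0 + 1 by norm_num)
    rcases hd with hd | hd
    · have := hd 0; linarith
    · exact .inr ⟨hm, hd⟩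

/-- A homeomorphism of the circle preserves orientation if it has a monotone continuous lift of
degree one. -/
def OrientationPreserving (f : Circle ≃ₜ Circle) : Prop :=
  ∃ F : CircleDeg1Lift, IsLift F f

theorem orientationPreserving_mul_self (f : Circle ≃ₜ Circle) : OrientationPreserving (f * f) := by
  obtain ⟨F, hF⟩ := exists_isLift f.continuous
  rcases hF.strictMono_or_strictAnti with ⟨hm, hd⟩ | ⟨hm, hd⟩
  · exact ⟨⟨⟨F ∘ F, (hm.comp hm).monotone⟩, fun t => by simp [hd]⟩, hF.comp hF⟩
  · refine ⟨⟨⟨F ∘ F, (hm.comp hm).monotone⟩, fun t => ?_⟩, hF.comp hF⟩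
    have := hd (F t - 1)
    simp only [comp_apply, hd]
    rw [sub_add_cancel] at this
    linarith

theorem OrientationPreserving.mul {f g : Circle ≃ₜ Circle} (hf : OrientationPreserving f)
    (hg : OrientationPreserving g) : OrientationPreserving (f * g) := by
  obtain ⟨F, hF⟩ := hf
  obtain ⟨G, hG⟩ := hg
  exact ⟨F * G, hF.comp hG⟩

/-! ### Fixed points from algebraic relations -/

/-- The translation number of a lift changes by `n` under the translation by `n`. -/
theorem translationNumber_translate_mul (F : CircleDeg1Lift) (n : ℤ) :
    (CircleDeg1Lift.translate (Multiplicative.ofAdd (n : ℝ)) * F).translationNumber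
      = n + F.translationNumber := by
  rw [CircleDeg1Lift.translationNumber_mul_of_commute, CircleDeg1Lift.translationNumber_translate]
  refine CircleDeg1Lift.ext fun t => ?_
  simp [CircleDeg1Lift.mul_apply]

theorem exists_fixed_of_translationNumber_eq_int {f : Circle ≃ₜ Circle} {F : CircleDeg1Lift}
    (hF : IsLift F f) {n : ℤ} (h : F.translationNumber = n) : ∃ z, f z = z := by
  obtain ⟨x, hx⟩ := (F.translationNumber_eq_int_iff hF.continuous).1 h
  exact ⟨circ x, by rw [← hF.circ_apply, hx, circ_add_int]⟩

/-- A homeomorphism conjugate to its own square has rotation number zero, hence a fixed point. -/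
theorem exists_fixed_of_conj_sq {f a : Circle ≃ₜ Circle} (hf : OrientationPreserving f)
    (ha : OrientationPreserving a) (h : a * f = f * f * a) : ∃ z, f z = z := by
  obtain ⟨F, hF⟩ := hf
  obtain ⟨A, hA⟩ := ha
  have h1 : IsLift (A ∘ F) (a * f : Circle ≃ₜ Circle) := hA.comp hF
  have h2 : IsLift (F ∘ F ∘ A) (f * f * a : Circle ≃ₜ Circle) := hF.comp (hF.comp hA)
  rw [h] at h1
  obtain ⟨n, hn⟩ := h1.exists_eq_add_int h2
  have key := CircleDeg1Lift.translationNumber_eq_of_semiconj (f := A) (g₁ := F)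
    (g₂ := CircleDeg1Lift.translate (Multiplicative.ofAdd (n : ℝ)) * (F * F)) (fun t => by
      simpa [CircleDeg1Lift.mul_apply, add_comm] using hn t)
  rw [translationNumber_translate_mul,
    CircleDeg1Lift.translationNumber_mul_of_commute (Commute.refl F)] at key
  exact exists_fixed_of_translationNumber_eq_int hF (n := -n) (by push_cast; linarith)

/-- If `f` is conjugate to its inverse, its rotation number is `0` or `1 / 2`, so `f²` has a fixed
point. -/
theorem exists_fixed_of_conj_inv {f w : Circle ≃ₜ Circle} (hf : OrientationPreserving f)
    (hf' : OrientationPreserving f⁻¹) (hw : OrientationPreserving w) (h : w * f = f⁻¹ * w) :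
    ∃ z, (f * f) z = z := by
  obtain ⟨F, hF⟩ := hf
  obtain ⟨G, hG⟩ := hf'
  obtain ⟨W, hW⟩ := hw
  have h1 : IsLift (W ∘ F) (w * f : Circle ≃ₜ Circle) := hW.comp hF
  have h2 : IsLift (G ∘ W) (f⁻¹ * w : Circle ≃ₜ Circle) := hG.comp hW
  rw [h] at h1
  obtain ⟨n, hn⟩ := h1.exists_eq_add_int h2
  have key := CircleDeg1Lift.translationNumber_eq_of_semiconj (f := W) (g₁ := F)
    (g₂ := CircleDeg1Lift.translate (Multiplicative.ofAdd (n : ℝ)) * G) (fun t => by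
      simpa [CircleDeg1Lift.mul_apply, add_comm] using hn t)
  rw [translationNumber_translate_mul] at key
  have h3 : IsLift (F ∘ G) (fun z => z) :=
    ⟨hF.continuous.comp hG.continuous, fun t => by
      rw [comp_apply, hF.circ_apply, hG.circ_apply]; exact f.apply_symm_apply _⟩
  have h4 : IsLift (G ∘ F) (fun z => z) :=
    ⟨hG.continuous.comp hF.continuous, fun t => by
      rw [comp_apply, hG.circ_apply, hF.circ_apply]; exact f.symm_apply_apply _⟩
  obtain ⟨m, hm⟩ := h3.exists_eq_add_int IsLift.id
  obtain ⟨k, hk⟩ := h4.exists_eq_add_int IsLift.id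
  simp only [comp_apply] at hm hk
  have hmk : (m : ℝ) = k := by
    have e := hk (G 0)
    rw [hm 0, CircleDeg1Lift.map_add_int] at e
    linarith
  have hcomm : Commute F G := CircleDeg1Lift.ext fun t => by
    simp [CircleDeg1Lift.mul_apply, hm, hk, hmk]
  have e1 := CircleDeg1Lift.translationNumber_mul_of_commute hcomm
  have e2 : F * G = CircleDeg1Lift.translate (Multiplicative.ofAdd (m : ℝ)) * 1 :=
    CircleDeg1Lift.ext fun t => by simp [CircleDeg1Lift.mul_apply, hm, add_comm]
  rw [e2, translationNumber_translate_mul, CircleDeg1Lift.translationNumber_one] at e1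
  refine exists_fixed_of_translationNumber_eq_int (F := F * F) (n := n + m) (hF.comp hF) ?_
  rw [CircleDeg1Lift.translationNumber_mul_of_commute (Commute.refl F)]
  push_cast
  linarith

/-- An orientation preserving homeomorphism which fixes `circ t₀` has a lift which fixes `t₀`. -/
theorem OrientationPreserving.exists_lift_fixing {f : Circle ≃ₜ Circle}
    (hf : OrientationPreserving f) {t₀ : ℝ} (h : f (circ t₀) = circ t₀) :
    ∃ F : CircleDeg1Lift, IsLift F f ∧ F t₀ = t₀ := by
  obtain ⟨F, hF⟩ := hf
  obtain ⟨n, hn⟩ := circ_eq_iff.1 ((hF.circ_apply t₀).trans h)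
  refine ⟨CircleDeg1Lift.translate (Multiplicative.ofAdd ((-n : ℤ) : ℝ)) * F, ?_, ?_⟩
  · convert hF.add_int (-n) using 1
    ext t
    simp [CircleDeg1Lift.mul_apply, add_comm]
  · simp [CircleDeg1Lift.mul_apply, hn]

/-- An orientation preserving homeomorphism `f` with a fixed point has one in every nonempty closed
set mapped into itself: the orbits of `f` converge to fixed points. -/
theorem OrientationPreserving.exists_fixed_mem {f : Circle ≃ₜ Circle}
    (hf : OrientationPreserving f) (hfix : ∃ z, f z = z) {K : Set Circle} (hK : IsClosed K)
    (hne : K.Nonempty) (hinv : MapsTo f K K) : ∃ z ∈ K, f z = z := by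
  obtain ⟨z₀, hz₀⟩ := hfix
  obtain ⟨t₀, rfl⟩ := circ_surjective z₀
  obtain ⟨F, hF, hF0⟩ := hf.exists_lift_fixing hz₀
  obtain ⟨z, hz⟩ := hne
  obtain ⟨x, rfl⟩ := circ_surjective z
  have hlift : ∀ n : ℕ, circ (F^[n] x) = f^[n] (circ x) := fun n => by
    induction n with
    | zero => rfl
    | succ k ih => rw [iterate_succ_apply', iterate_succ_apply', hF.circ_apply, ih]
  have hmem : ∀ n : ℕ, circ (F^[n] x) ∈ K := fun n => by
    rw [hlift]; exact hinv.iterate n hz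
  -- a limit of the lifted orbit lies over a fixed point in `K`
  have hlim : (∃ l, Tendsto (fun n : ℕ => F^[n] x) atTop (𝓝 l)) → ∃ z ∈ K, f z = z := by
    rintro ⟨l, hl⟩
    refine ⟨circ l, hK.mem_of_tendsto ((continuous_circ.tendsto l).comp hl)
      (Eventually.of_forall hmem), ?_⟩
    rw [← hF.circ_apply]
    congr 1
    refine tendsto_nhds_unique ((hF.continuous.tendsto l).comp hl) ?_
    refine (hl.comp (tendsto_add_atTop_nat 1)).congr fun n => ?_
    simp only [comp_apply, iterate_succ_apply']
  obtain ⟨k, hk⟩ := exists_int_gt (x - t₀)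
  obtain ⟨k', hk'⟩ := exists_int_lt (x - t₀)
  have hfixed : ∀ (m : ℤ) (n : ℕ), F^[n] (t₀ + m) = t₀ + m := fun m n =>
    iterate_fixed (by rw [CircleDeg1Lift.map_add_int, hF0]) n
  have hup : ∀ n : ℕ, F^[n] x ≤ t₀ + k := fun n =>
    (F.monotone.iterate n (by linarith : x ≤ t₀ + k)).trans_eq (hfixed k n)
  have hlow : ∀ n : ℕ, t₀ + k' ≤ F^[n] x := fun n =>
    (hfixed k' n).symm.trans_le (F.monotone.iterate n (by linarith : t₀ + k' ≤ x))
  rcases le_total x (F x) with hx | hx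
  · exact hlim ⟨_, tendsto_atTop_ciSup (F.monotone.monotone_iterate_of_le_map hx)
      ⟨t₀ + k, forall_mem_range.2 hup⟩⟩
  · exact hlim ⟨_, tendsto_atTop_ciInf (F.monotone.antitone_iterate_of_map_le hx)
      ⟨t₀ + k', forall_mem_range.2 hlow⟩⟩

/-- Commuting orientation preserving homeomorphisms, each with a fixed point, have a common fixed
point in every nonempty closed set invariant under all of them. -/
theorem exists_common_fixed_mem {ι : Type*} (f : ι → Circle ≃ₜ Circle)
    (hf : ∀ i, OrientationPreserving (f i)) (hfix : ∀ i, ∃ z, f i z = z)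
    (hcomm : ∀ i j z, f i (f j z) = f j (f i z)) {K : Set Circle} (hK : IsClosed K)
    (hne : K.Nonempty) (hinv : ∀ i, MapsTo (f i) K K) : ∃ z ∈ K, ∀ i, f i z = z := by
  have hcl : ∀ i, IsClosed {z | f i z = z} := fun i =>
    isClosed_eq (f i).continuous continuous_id
  have hfin : ∀ u : Finset ι, (K ∩ ⋂ i ∈ u, {z | f i z = z}).Nonempty := by
    classical
    intro u
    induction u using Finset.induction_on with
    | empty => simpa using hne
    | insert i u _ ih =>
      obtain ⟨z, hz, hiz⟩ := (hf i).exists_fixed_mem (hfix i)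
        (hK.inter (isClosed_biInter fun j _ => hcl j)) ih (by
          rintro z ⟨hz, hzu⟩
          refine ⟨hinv i hz, mem_iInter₂.2 fun j hj => ?_⟩
          have : f j z = z := mem_iInter₂.1 hzu j hj
          change f j (f i z) = f i z
          rw [hcomm, this])
      refine ⟨z, hz.1, mem_iInter₂.2 fun j hj => ?_⟩
      rcases Finset.mem_insert.1 hj with rfl | hj
      · exact hiz
      · exact mem_iInter₂.1 hz.2 j hj
  obtain ⟨z, hz, hzi⟩ := hK.isCompact.inter_iInter_nonempty _ hcl hfin
  exact ⟨z, hz, fun i => mem_iInter.1 hzi i⟩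

/-- An orientation preserving involution of the circle with a fixed point is the identity. -/
theorem OrientationPreserving.eq_one_of_mul_self {f : Circle ≃ₜ Circle}
    (hf : OrientationPreserving f) (hff : f * f = 1) {z : Circle} (hz : f z = z) : f = 1 := by
  obtain ⟨t₀, rfl⟩ := circ_surjective z
  obtain ⟨F, hF, hF0⟩ := hf.exists_lift_fixing hz
  have h2 : IsLift (F ∘ F) (fun z => z) := by
    have : IsLift (F ∘ F) (f * f : Circle ≃ₜ Circle) := hF.comp hF
    rwa [hff] at this
  have h3 : ∀ t, F (F t) = t := congrFun (h2.eq_of_eq IsLift.id (t₀ := t₀) (by simp [hF0]))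
  refine Homeomorph.ext fun z => ?_
  obtain ⟨t, rfl⟩ := circ_surjective z
  rw [← hF.circ_apply]
  change circ (F t) = circ t
  congr 1
  rcases le_total t (F t) with h | h
  · exact le_antisymm ((F.monotone h).trans_eq (h3 t)) h
  · exact le_antisymm h ((h3 t).symm.trans_le (F.monotone h))

/-! ### One-parameter subgroups of `SL(2,ℝ)` -/

/-- The unipotent matrix `(1 s; 0 1)`. -/
def upper (s : ℝ) : SL(2, ℝ) := ⟨!![1, s; 0, 1], by simp [Matrix.det_fin_two]⟩

/-- The diagonal matrix `(eʳ 0; 0 e⁻ʳ)`. -/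
def dilation (r : ℝ) : SL(2, ℝ) :=
  ⟨!![Real.exp r, 0; 0, Real.exp (-r)], by simp [Matrix.det_fin_two, ← Real.exp_add]⟩

/-- The rotation of the plane by the angle `θ`. -/
def rotation (θ : ℝ) : SL(2, ℝ) :=
  ⟨!![Real.cos θ, -Real.sin θ; Real.sin θ, Real.cos θ], by
    simp only [Matrix.det_fin_two_of]; nlinarith [Real.sin_sq_add_cos_sq θ]⟩

/-- The Weyl element `(0 -1; 1 0)`. -/
def weyl : SL(2, ℝ) := ⟨!![0, -1; 1, 0], by simp [Matrix.det_fin_two]⟩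

theorem coe_upper (s : ℝ) : (upper s : Matrix (Fin 2) (Fin 2) ℝ) = !![1, s; 0, 1] := rfl

theorem coe_dilation (r : ℝ) :
    (dilation r : Matrix (Fin 2) (Fin 2) ℝ) = !![Real.exp r, 0; 0, Real.exp (-r)] := rfl

theorem coe_rotation (θ : ℝ) : (rotation θ : Matrix (Fin 2) (Fin 2) ℝ) =
    !![Real.cos θ, -Real.sin θ; Real.sin θ, Real.cos θ] := rfl

theorem coe_weyl : (weyl : Matrix (Fin 2) (Fin 2) ℝ) = !![0, -1; 1, 0] := rfl

theorem upper_add (s t : ℝ) : upper (s + t) = upper s * upper t := by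
  ext i j; fin_cases i <;> fin_cases j <;> simp [coe_upper, Matrix.mul_apply, add_comm]

theorem dilation_add (s t : ℝ) : dilation (s + t) = dilation s * dilation t := by
  ext i j; fin_cases i <;> fin_cases j <;>
    simp [coe_dilation, Matrix.mul_apply, Real.exp_add, mul_comm]

theorem rotation_add (s t : ℝ) : rotation (s + t) = rotation s * rotation t := by
  ext i j; fin_cases i <;> fin_cases j <;>
    simp [coe_rotation, Matrix.mul_apply, Real.cos_add, Real.sin_add] <;> ring

theorem dilation_zero : dilation 0 = 1 := by
  ext i j; fin_cases i <;> fin_cases j <;> simp [coe_dilation]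

theorem upper_zero : upper 0 = 1 := by
  ext i j; fin_cases i <;> fin_cases j <;> simp [coe_upper]

theorem dilation_mul_upper (r s : ℝ) :
    dilation r * upper s = upper (Real.exp (2 * r) * s) * dilation r := by
  have h : Real.exp (2 * r) * Real.exp (-r) = Real.exp r := by rw [← Real.exp_add]; congr 1; ring
  ext i j; fin_cases i <;> fin_cases j <;> simp [coe_dilation, coe_upper, Matrix.mul_apply]
  linear_combination (-s) * h

theorem weyl_mul_dilation (r : ℝ) : weyl * dilation r = dilation (-r) * weyl := by
  ext i j; fin_cases i <;> fin_cases j <;> simp [coe_dilation, coe_weyl, Matrix.mul_apply]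

theorem weyl_mul_self : weyl * weyl = -1 := by
  ext i j; fin_cases i <;> fin_cases j <;> simp [coe_weyl, Matrix.mul_apply]

theorem rotation_pi_div_two : rotation (Real.pi / 4) * rotation (Real.pi / 4) = weyl := by
  rw [← rotation_add, show Real.pi / 4 + Real.pi / 4 = Real.pi / 2 by ring]
  ext i j; fin_cases i <;> fin_cases j <;> simp [coe_rotation, coe_weyl]

theorem eq_upper_mul_dilation {g : SL(2, ℝ)} (h : g 1 0 = 0) (hpos : 0 < g 0 0) :
    g = upper (g 0 1 * g 0 0) * dilation (Real.log (g 0 0)) := by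
  have hdet := g.det_coe
  rw [Matrix.det_fin_two, h] at hdet
  have h0 := hpos.ne'
  have h11 : (g 0 0)⁻¹ = g 1 1 := by field_simp; linarith
  ext i j; fin_cases i <;> fin_cases j <;>
    simp [coe_dilation, coe_upper, Matrix.mul_apply, Real.exp_neg, Real.exp_log hpos, h, h11]
  linear_combination (-(g 0 1)) * hdet

/-- Upper triangular matrices are, up to sign, products of a unipotent and a positive diagonal
matrix. -/
theorem mem_of_lower_left_eq_zero {S : Subgroup SL(2, ℝ)} (hneg : (-1 : SL(2, ℝ)) ∈ S)
    (hu : ∀ s, upper s ∈ S) (hd : ∀ r, dilation r ∈ S) {g : SL(2, ℝ)} (h : g 1 0 = 0) : g ∈ S := by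
  have hpos : ∀ g : SL(2, ℝ), g 1 0 = 0 → 0 < g 0 0 → g ∈ S := fun g h hp => by
    rw [eq_upper_mul_dilation h hp]
    exact S.mul_mem (hu _) (hd _)
  have hne : g 0 0 ≠ 0 := fun h0 => by
    have hdet := g.det_coe
    rw [Matrix.det_fin_two, h, h0] at hdet
    simp at hdet
  rcases lt_or_gt_of_ne hne with h0 | h0
  · have := S.mul_mem hneg (hpos (-g) (by simpa using h) (by simpa using h0))
    simpa using this
  · exact hpos g h h0

/-- The upper triangular matrices form a maximal subgroup of `SL(2,ℝ)`, by the Bruhat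
decomposition. -/
theorem eq_top_of_lower_left_ne_zero {S : Subgroup SL(2, ℝ)}
    (hB : ∀ g : SL(2, ℝ), g 1 0 = 0 → g ∈ S)
    {g : SL(2, ℝ)} (hg : g ∈ S) (hc : g 1 0 ≠ 0) : S = ⊤ := by
  -- Bruhat decomposition: `(a b; c d) = (1/c a; 0 c) w (1 d/c; 0 1)`
  have key : ∀ h : SL(2, ℝ), h 1 0 ≠ 0 → ∃ b₁ ∈ S, ∃ b₂ ∈ S, h = b₁ * weyl * b₂ := fun h hc => by
    obtain ⟨b, hb⟩ : ∃ b : SL(2, ℝ), (b : Matrix (Fin 2) (Fin 2) ℝ) =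
        !![(h 1 0)⁻¹, h 0 0; 0, h 1 0] :=
      ⟨⟨!![(h 1 0)⁻¹, h 0 0; 0, h 1 0], by simp [Matrix.det_fin_two, hc]⟩, rfl⟩
    refine ⟨b, hB _ (by simp [hb]), upper (h 1 1 / h 1 0), hB _ (by simp [coe_upper]), ?_⟩
    have hdet := h.det_coe
    rw [Matrix.det_fin_two] at hdet
    ext i j; fin_cases i <;> fin_cases j <;> simp [hb, coe_upper, coe_weyl, Matrix.mul_apply]
    · field_simp
      linear_combination -hdet
    · field_simp
  have hw : weyl ∈ S := by
    obtain ⟨b₁, h₁, b₂, h₂, rfl⟩ := key g hc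
    rwa [S.mul_mem_cancel_right h₂, S.mul_mem_cancel_left h₁] at hg
  refine eq_top_iff.2 fun h _ => ?_
  by_cases h0 : h 1 0 = 0
  · exact hB h h0
  · obtain ⟨b₁, h₁, b₂, h₂, rfl⟩ := key h h0
    exact S.mul_mem (S.mul_mem h₁ hw) h₂

/-! ### The projective action -/

theorem moebius_rotation (θ : ℝ) (z : Circle) :
    moebius (rotation θ) z = circ (θ / Real.pi) * z := by
  have hb : beta (rotation θ) = 0 := by apply Complex.ext <;> simp [beta, coe_rotation]
  have ha : alpha (rotation θ) = Complex.exp (θ * Complex.I) := by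
    apply Complex.ext <;> simp [alpha, coe_rotation, Complex.exp_re, Complex.exp_im]
  have hc : conj (alpha (rotation θ)) = Complex.exp (-(θ * Complex.I)) := by
    rw [ha, ← Complex.exp_conj]; simp
  apply Circle.ext
  rw [coe_moebius, hb, hc, ha, Circle.coe_mul, circ, Circle.coe_exp]
  rw [show 2 * Real.pi * (θ / Real.pi) = θ + θ by field_simp; ring]
  simp only [map_zero, zero_mul, zero_add, add_zero]
  rw [mul_comm _ (z : ℂ), mul_div_assoc, ← Complex.exp_sub, mul_comm]
  congr 2
  push_cast
  ring

theorem exists_moebius_eq (z z' : Circle) : ∃ g, moebius g z = z' := by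
  obtain ⟨t, ht⟩ := circ_surjective (z' * z⁻¹)
  refine ⟨rotation (Real.pi * t), ?_⟩
  rw [moebius_rotation, mul_div_cancel_left₀ _ Real.pi_pos.ne', ht, inv_mul_cancel_right]

theorem moebius_one_eq_one_iff (g : SL(2, ℝ)) : moebius g 1 = 1 ↔ g 1 0 = 0 := by
  have hd := denom_ne_zero g 1
  rw [← Circle.coe_inj, coe_moebius, div_eq_iff hd, Circle.coe_one, one_mul]
  constructor
  · intro h
    have := congrArg Complex.im h
    simp [alpha, beta] at this
    linarith
  · intro h
    apply Complex.ext <;> simp [alpha, beta, h] <;> ring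

/-- The affine chart `ℝ → S¹ ∖ {1}` of the projective line, in which `upper s` is the translation
by `s` and `dilation r` the multiplication by `e²ʳ`. -/
def affinePoint (x : ℝ) : Circle := moebius (upper x) (-1)

theorem moebius_upper_affinePoint (s x : ℝ) :
    moebius (upper s) (affinePoint x) = affinePoint (s + x) := by
  rw [affinePoint, ← moebius_mul, ← upper_add, affinePoint]

theorem moebius_dilation_neg_one (r : ℝ) : moebius (dilation r) (-1) = -1 := by
  have hd := denom_ne_zero (dilation r) (-1)
  rw [← Circle.coe_inj, coe_moebius, div_eq_iff hd]
  apply Complex.ext <;> simp [alpha, beta, coe_dilation]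

theorem moebius_dilation_affinePoint (r x : ℝ) :
    moebius (dilation r) (affinePoint x) = affinePoint (Real.exp (2 * r) * x) := by
  rw [affinePoint, ← moebius_mul, dilation_mul_upper, moebius_mul, moebius_dilation_neg_one,
    affinePoint]

theorem coe_affinePoint (x : ℝ) :
    (affinePoint x : ℂ) = (x * Complex.I - 1) / (x * Complex.I + 1) := by
  rw [affinePoint, coe_moebius]
  congr 1 <;> apply Complex.ext <;> simp [alpha, beta, coe_upper] <;> ring

theorem affinePoint_denom_ne_zero (x : ℝ) : (x * Complex.I + 1 : ℂ) ≠ 0 := fun h => by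
  have := congrArg Complex.re h
  simp at this

theorem affinePoint_ne_one (x : ℝ) : affinePoint x ≠ 1 := fun h => by
  have := congrArg (fun z : Circle => (z : ℂ)) h
  simp only [coe_affinePoint, Circle.coe_one] at this
  rw [div_eq_one_iff_eq (affinePoint_denom_ne_zero x)] at this
  have := congrArg Complex.re this
  simp at this
  norm_num at this

theorem affinePoint_injective : Injective affinePoint := fun x y h => by
  have := congrArg (fun z : Circle => (z : ℂ)) h
  simp only [coe_affinePoint] at this
  rw [div_eq_div_iff (affinePoint_denom_ne_zero x) (affinePoint_denom_ne_zero y)] at this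
  have := congrArg Complex.im this
  simp at this
  linarith

/-- The inverse of the affine chart: `e^{iθ} ↦ cot (θ / 2) = sin θ / (1 - cos θ)`. -/
theorem affinePoint_div {z : Circle} (hz : z ≠ 1) :
    affinePoint ((z : ℂ).im / (1 - (z : ℂ).re)) = z := by
  have hn : (z : ℂ).re * (z : ℂ).re + (z : ℂ).im * (z : ℂ).im = 1 := by
    have := Circle.normSq_coe z
    rwa [Complex.normSq_apply] at this
  have hre : 1 - (z : ℂ).re ≠ 0 := fun h => hz <| Circle.ext <| by
    have h1 : (z : ℂ).re = 1 := by linarith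
    have h2 : (z : ℂ).im = 0 := by rw [h1] at hn; nlinarith
    apply Complex.ext <;> simp [h1, h2]
  rw [← Circle.coe_inj, coe_affinePoint, div_eq_iff (affinePoint_denom_ne_zero _)]
  set x : ℝ := (z : ℂ).im / (1 - (z : ℂ).re) with hx
  have hx1 : x * (1 - (z : ℂ).re) = (z : ℂ).im := div_mul_cancel₀ _ hre
  have hx2 : x * (z : ℂ).im = 1 + (z : ℂ).re := by
    rw [hx]
    field_simp
    linarith
  apply Complex.ext
  · simp
    linarith
  · simp
    linarith

/-! ### The Borel subgroup has a fixed point -/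

section Action

variable {Ψ : SL(2, ℝ) →* (Circle ≃ₜ Circle)}

/-- The stabiliser of a point under an action of `SL(2,ℝ)` on the circle. -/
def pointStabilizer (Ψ : SL(2, ℝ) →* (Circle ≃ₜ Circle)) (z : Circle) : Subgroup SL(2, ℝ) where
  carrier := {g | Ψ g z = z}
  mul_mem' {g h} hg hh := by
    change Ψ (g * h) z = z
    rw [map_mul]
    exact (congrArg (Ψ g) hh).trans hg
  one_mem' := by
    change Ψ 1 z = z
    rw [map_one]; rfl
  inv_mem' {g} hg := by
    change Ψ g⁻¹ z = z
    rw [map_inv]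
    exact (Homeomorph.symm_apply_eq (Ψ g)).2 (Eq.symm hg)

theorem orientationPreserving_upper (Ψ : SL(2, ℝ) →* (Circle ≃ₜ Circle)) (s : ℝ) :
    OrientationPreserving (Ψ (upper s)) := by
  rw [← add_halves s, upper_add, map_mul]
  exact orientationPreserving_mul_self _

theorem orientationPreserving_dilation (Ψ : SL(2, ℝ) →* (Circle ≃ₜ Circle)) (r : ℝ) :
    OrientationPreserving (Ψ (dilation r)) := by
  rw [← add_halves r, dilation_add, map_mul]
  exact orientationPreserving_mul_self _

theorem orientationPreserving_weyl (Ψ : SL(2, ℝ) →* (Circle ≃ₜ Circle)) :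
    OrientationPreserving (Ψ weyl) := by
  rw [← rotation_pi_div_two, map_mul]
  exact orientationPreserving_mul_self _

theorem exists_fixed_upper (Ψ : SL(2, ℝ) →* (Circle ≃ₜ Circle)) (s : ℝ) :
    ∃ z, Ψ (upper s) z = z := by
  refine exists_fixed_of_conj_sq (orientationPreserving_upper Ψ s)
    (orientationPreserving_dilation Ψ (Real.log 2 / 2)) ?_
  rw [← map_mul, ← map_mul, ← map_mul, dilation_mul_upper, ← upper_add]
  rw [mul_div_cancel₀ _ two_ne_zero, Real.exp_log two_pos, two_mul]

theorem exists_fixed_dilation (Ψ : SL(2, ℝ) →* (Circle ≃ₜ Circle)) (r : ℝ) :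
    ∃ z, Ψ (dilation r) z = z := by
  have hinv : (Ψ (dilation (r / 2)))⁻¹ = Ψ (dilation (-(r / 2))) := by
    rw [← map_inv]
    congr 1
    rw [inv_eq_iff_mul_eq_one, ← dilation_add, add_neg_cancel, dilation_zero]
  have := exists_fixed_of_conj_inv (orientationPreserving_dilation Ψ (r / 2))
    (by rw [hinv]; exact orientationPreserving_dilation Ψ _) (orientationPreserving_weyl Ψ)
    (by rw [hinv, ← map_mul, ← map_mul, weyl_mul_dilation])
  rwa [← map_mul, ← dilation_add, add_halves] at this

/-- The Borel subgroup fixes a point: first the unipotent subgroup does, then the diagonal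
subgroup, which normalises it, has a fixed point in its fixed point set. -/
theorem exists_fixed_borel (hneg : Ψ (-1) = 1) :
    ∃ z₀, ∀ g : SL(2, ℝ), g 1 0 = 0 → Ψ g z₀ = z₀ := by
  obtain ⟨z, -, hz⟩ := exists_common_fixed_mem (fun s => Ψ (upper s))
    (orientationPreserving_upper Ψ) (exists_fixed_upper Ψ) (fun s t z => by
      change (Ψ (upper s) * Ψ (upper t)) z = (Ψ (upper t) * Ψ (upper s)) z
      rw [← map_mul, ← map_mul, ← upper_add, ← upper_add, add_comm])
    isClosed_univ univ_nonempty (fun _ => mapsTo_univ _ _)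
  have hK : IsClosed {z | ∀ s, Ψ (upper s) z = z} := by
    rw [ofPred_forall]
    exact isClosed_iInter fun s => isClosed_eq (Ψ (upper s)).continuous continuous_id
  obtain ⟨z₀, hz₀, hd⟩ := exists_common_fixed_mem (fun r => Ψ (dilation r))
    (orientationPreserving_dilation Ψ) (exists_fixed_dilation Ψ) (fun s t z => by
      change (Ψ (dilation s) * Ψ (dilation t)) z = (Ψ (dilation t) * Ψ (dilation s)) z
      rw [← map_mul, ← map_mul, ← dilation_add, ← dilation_add, add_comm])
    hK ⟨z, hz⟩ (fun r z hz s => by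
      change (Ψ (upper s) * Ψ (dilation r)) z = Ψ (dilation r) z
      have h := dilation_mul_upper r (Real.exp (2 * -r) * s)
      rw [← mul_assoc, ← Real.exp_add, ← mul_add, add_neg_cancel, mul_zero, Real.exp_zero,
        one_mul] at h
      rw [← map_mul, ← h, map_mul]
      exact congrArg (Ψ (dilation r)) (hz _))
  refine ⟨z₀, fun g hg => ?_⟩
  refine mem_of_lower_left_eq_zero
    (S := pointStabilizer Ψ z₀) ?_ ?_ ?_ hg
  · change Ψ (-1) z₀ = z₀
    rw [hneg]; rfl
  · exact hz₀
  · exact hd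

/-- The stabiliser of a fixed point of the Borel subgroup is not larger: otherwise the action
has a global fixed point, the involution `w` of `PSL(2,ℝ)` acts trivially, and so does the normal
subgroup which it generates. -/
theorem lower_left_eq_zero_of_fixed (hneg : Ψ (-1) = 1) (hnt : Ψ ≠ 1) {z₀ : Circle}
    (hz₀ : ∀ g : SL(2, ℝ), g 1 0 = 0 → Ψ g z₀ = z₀) {g : SL(2, ℝ)} (hg : Ψ g z₀ = z₀) :
    g 1 0 = 0 := by
  by_contra hc
  have htop : pointStabilizer Ψ z₀ = ⊤ :=
    eq_top_of_lower_left_ne_zero hz₀ hg hc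
  have hw0 : Ψ weyl z₀ = z₀ := by
    have : weyl ∈ pointStabilizer Ψ z₀ := htop ▸ Subgroup.mem_top _
    exact this
  have hw : Ψ weyl = 1 := (orientationPreserving_weyl Ψ).eq_one_of_mul_self
    (by rw [← map_mul, weyl_mul_self, hneg]) hw0
  have hd : ∀ r, Ψ (dilation r) = 1 := fun r => by
    have h := congrArg Ψ (weyl_mul_dilation (r / 2))
    rw [map_mul, map_mul, hw, one_mul, mul_one] at h
    rw [← add_halves r, dilation_add, map_mul]
    nth_rw 1 [h]
    rw [← map_mul, ← dilation_add, neg_add_cancel, dilation_zero, map_one]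
  have hu : ∀ s, Ψ (upper s) = 1 := fun s => by
    have h := congrArg Ψ (dilation_mul_upper (Real.log 2 / 2) s)
    rw [map_mul, map_mul, hd, one_mul, mul_one, mul_div_cancel₀ _ two_ne_zero,
      Real.exp_log two_pos, two_mul, upper_add, map_mul] at h
    exact left_eq_mul.1 h
  have hker : Ψ.ker = ⊤ := eq_top_of_lower_left_ne_zero
    (fun g hg => mem_of_lower_left_eq_zero hneg hu hd hg) hw (by simp [coe_weyl])
  exact hnt (MonoidHom.ker_eq_top_iff.1 hker)

/-! ### The orbit map -/

/-- The orbit map `g • 1 ↦ Ψ g z₀` on the projective line is well defined and injective. -/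
theorem exists_orbitMap (hneg : Ψ (-1) = 1) (hnt : Ψ ≠ 1) :
    ∃ j : Circle → Circle, Injective j ∧ ∀ g z, j (moebius g z) = Ψ g (j z) := by
  obtain ⟨z₀, hz₀⟩ := exists_fixed_borel hneg
  choose σ hσ using exists_moebius_eq 1
  have hinv : ∀ g h : SL(2, ℝ), Ψ g z₀ = Ψ h z₀ ↔ Ψ (h⁻¹ * g) z₀ = z₀ := fun g h => by
    rw [map_mul, map_inv]
    exact (Homeomorph.symm_apply_eq (Ψ h)).symm
  have hinv' : ∀ g h : SL(2, ℝ), moebius g 1 = moebius h 1 ↔ moebius (h⁻¹ * g) 1 = 1 :=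
      fun g h => by
    rw [moebius_mul]
    constructor
    · intro e; rw [e, ← moebius_mul, inv_mul_cancel, moebius_one]
    · intro e
      have := congrArg (moebius h) e
      rwa [← moebius_mul, mul_inv_cancel, moebius_one] at this
  have key : ∀ g h : SL(2, ℝ), Ψ g z₀ = Ψ h z₀ ↔ moebius g 1 = moebius h 1 := fun g h => by
    rw [hinv, hinv', moebius_one_eq_one_iff]
    exact ⟨lower_left_eq_zero_of_fixed hneg hnt hz₀, hz₀ _⟩
  refine ⟨fun z => Ψ (σ z) z₀, fun z z' h => ?_, fun g z => ?_⟩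
  · rw [← hσ z, ← hσ z']
    exact (key _ _).1 h
  · change _ = (Ψ g * Ψ (σ z)) z₀
    rw [← map_mul, key, hσ, moebius_mul, hσ]

end Action

/-- The affine group acts transitively on ordered pairs of reals: an injective map `ℝ → ℝ` which
intertwines it with increasing maps is monotone or antitone. -/
theorem strictMono_or_strictAnti_of_affine {J : ℝ → ℝ} (hinj : Injective J)
    (hJ : ∀ r s, ∃ F : ℝ → ℝ, StrictMono F ∧ ∀ x, F (J x) = J (s + Real.exp (2 * r) * x)) :
    StrictMono J ∨ StrictAnti J := by
  have key : ∀ x y, x < y → ∃ F : ℝ → ℝ, StrictMono F ∧ F (J 0) = J x ∧ F (J 1) = J y := by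
    intro x y hxy
    obtain ⟨F, hF, h⟩ := hJ (Real.log (y - x) / 2) x
    rw [mul_div_cancel₀ _ two_ne_zero, Real.exp_log (sub_pos.2 hxy)] at h
    exact ⟨F, hF, by rw [h]; ring_nf, by rw [h]; ring_nf⟩
  rcases lt_or_gt_of_ne (hinj.ne (zero_ne_one : (0 : ℝ) ≠ 1)) with h01 | h01
  · refine .inl fun x y hxy => ?_
    obtain ⟨F, hF, h0, h1⟩ := key x y hxy
    rw [← h0, ← h1]; exact hF h01
  · refine .inr fun x y hxy => ?_
    obtain ⟨F, hF, h0, h1⟩ := key x y hxy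
    rw [← h0, ← h1]; exact hF h01

/-- A monotone or antitone function has a point of continuity; equivariance under translations
makes all points alike. -/
theorem continuous_of_translation_equivariant {J : ℝ → ℝ} (hmono : StrictMono J ∨ StrictAnti J)
    (hJ : ∀ s, ∃ F : ℝ → ℝ, Continuous F ∧ ∀ x, F (J x) = J (s + x)) : Continuous J := by
  have hcount : {x | ¬ContinuousAt J x}.Countable :=
    hmono.elim (fun h => h.monotone.countable_not_continuousAt)
      (fun h => h.antitone.countable_not_continuousAt)
  obtain ⟨c, hc⟩ : ∃ c, ContinuousAt J c := by
    by_contra! h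
    exact not_countable_univ (hcount.mono fun x _ => h x)
  refine continuous_iff_continuousAt.2 fun x => ?_
  obtain ⟨F, hF, h⟩ := hJ (x - c)
  have h1 : ContinuousAt (fun y => F (J (y - (x - c)))) x :=
    hF.continuousAt.comp (ContinuousAt.comp (by simpa using hc) (by fun_prop))
  refine h1.congr (Eventually.of_forall fun y => ?_)
  simp [h]

/-- The orbit map is a homeomorphism, so every nontrivial action of `PSL(2,ℝ)` on the circle is
topologically conjugate to the projective action. -/
theorem exists_topological_conjugacy {Ψ : SL(2, ℝ) →* (Circle ≃ₜ Circle)} (hneg : Ψ (-1) = 1)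
    (hnt : Ψ ≠ 1) : ∃ j : Circle ≃ₜ Circle, ∀ g z, j (moebius g z) = Ψ g (j z) := by
  obtain ⟨j, hinj, hj⟩ := exists_orbitMap hneg hnt
  obtain ⟨t₀, ht₀⟩ := circ_surjective (j 1)
  -- lift of `j` along the affine chart
  have hex : ∀ x, ∃ y ∈ Ioo t₀ (t₀ + 1), circ y = j (affinePoint x) := fun x => by
    obtain ⟨y, hy⟩ := circ_surjective (j (affinePoint x))
    have hmem := toIcoMod_mem_Ico one_pos t₀ y
    have he : circ (toIcoMod one_pos t₀ y) = j (affinePoint x) := by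
      rw [toIcoMod, ← hy]
      simpa [sub_eq_add_neg] using circ_add_int y (-(toIcoDiv one_pos t₀ y))
    refine ⟨_, ⟨lt_of_le_of_ne hmem.1 fun h => ?_, hmem.2⟩, he⟩
    rw [← h, ht₀] at he
    exact affinePoint_ne_one x (hinj he).symm
  choose J hJmem hJ using hex
  have huniq : ∀ s ∈ Ioo t₀ (t₀ + 1), ∀ t ∈ Ioo t₀ (t₀ + 1), circ s = circ t → s = t := by
    rintro s ⟨hs, hs'⟩ t ⟨ht, ht'⟩ h
    obtain ⟨n, rfl⟩ := circ_eq_iff.1 h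
    have h1 : (n : ℝ) < 1 := by linarith
    have h2 : (-1 : ℝ) < n := by linarith
    have : n = 0 := by
      have : n < 1 := by exact_mod_cast h1
      have : -1 < n := by exact_mod_cast h2
      omega
    simp [this]
  have hJinj : Injective J := fun x y h =>
    affinePoint_injective (hinj (by rw [← hJ, ← hJ, h]))
  have hequi : ∀ g : SL(2, ℝ), g 1 0 = 0 → OrientationPreserving (Ψ g) →
      ∃ F : ℝ → ℝ, StrictMono F ∧ Continuous F ∧
        ∀ x y, moebius g (affinePoint x) = affinePoint y → F (J x) = J y := by
    intro g hg hop
    obtain ⟨F, hF, hF0⟩ := hop.exists_lift_fixing (t₀ := t₀)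
      (by rw [ht₀, ← hj, (moebius_one_eq_one_iff g).2 hg])
    have hFm : StrictMono F := F.strictMono_iff_injective.2 hF.injective_and_degree.1
    refine ⟨F, hFm, hF.continuous, fun x y hxy => huniq _ ⟨?_, ?_⟩ _ (hJmem y) ?_⟩
    · exact hF0.symm.trans_lt (hFm (hJmem x).1)
    · exact (hFm (hJmem x).2).trans_eq (by rw [F.map_add_one, hF0])
    · rw [hF.circ_apply, hJ, hJ, ← hj, hxy]
  have hmono : StrictMono J ∨ StrictAnti J := by
    refine strictMono_or_strictAnti_of_affine hJinj fun r s => ?_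
    obtain ⟨F, hF, -, h⟩ := hequi (upper s * dilation r) (by simp [coe_upper, coe_dilation])
      (by
        rw [map_mul]
        exact (orientationPreserving_upper Ψ s).mul (orientationPreserving_dilation Ψ r))
    exact ⟨F, hF, fun x => h _ _ (by
      rw [moebius_mul, moebius_dilation_affinePoint, moebius_upper_affinePoint])⟩
  have hJc : Continuous J := by
    refine continuous_of_translation_equivariant hmono fun s => ?_
    obtain ⟨F, -, hF, h⟩ := hequi (upper s) (by simp [coe_upper]) (orientationPreserving_upper Ψ s)
    exact ⟨F, hF, fun x => h _ _ (moebius_upper_affinePoint s x)⟩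
  have haff0 : affinePoint 0 = -1 := by rw [affinePoint, upper_zero, moebius_one]
  -- continuity, at `-1` through the affine chart and elsewhere by equivariance
  have hne : (-1 : Circle) ≠ 1 := haff0 ▸ affinePoint_ne_one 0
  have hc1 : ContinuousAt j (-1) := by
    have h1 : ContinuousAt (fun z : Circle => circ (J ((z : ℂ).im / (1 - (z : ℂ).re)))) (-1) := by
      refine (continuous_circ.comp hJc).continuousAt.comp ?_
      refine ContinuousAt.div (by fun_prop) (by fun_prop) ?_
      norm_num
    refine h1.congr ?_
    filter_upwards [isOpen_ne.mem_nhds hne] with z hz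
    rw [hJ, affinePoint_div hz]
  have hcm : ∀ g, Continuous (moebius g) := fun g => (contMDiff_moebius g 0).continuous
  have hc : Continuous j := continuous_iff_continuousAt.2 fun z => by
    obtain ⟨g, hg⟩ := exists_moebius_eq z (-1)
    have h1 : ContinuousAt (fun z => Ψ g⁻¹ (j (moebius g z))) z :=
      (Ψ g⁻¹).continuous.continuousAt.comp
        (ContinuousAt.comp (by rwa [hg]) (hcm g).continuousAt)
    refine h1.congr (Eventually.of_forall fun z => ?_)
    change Ψ g⁻¹ (j (moebius g z)) = j z
    rw [← hj, ← moebius_mul, inv_mul_cancel, moebius_one]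
  -- the range is open, again by a look at one point and equivariance
  have hnhds : range j ∈ 𝓝 (j (-1)) := by
    have hJ0 : range J ∈ 𝓝 (J 0) := by
      have hp : IsPreconnected (range J) := isPreconnected_range hJc
      rcases hmono with hm | hm
      · exact mem_of_superset
          (Icc_mem_nhds (hm (show (-1 : ℝ) < 0 by norm_num)) (hm one_pos))
          (hp.Icc_subset ⟨_, rfl⟩ ⟨_, rfl⟩)
      · exact mem_of_superset
          (Icc_mem_nhds (hm one_pos) (hm (show (-1 : ℝ) < 0 by norm_num)))
          (hp.Icc_subset ⟨_, rfl⟩ ⟨_, rfl⟩)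
    have := isOpenMap_circ.image_mem_nhds hJ0
    rw [hJ, haff0] at this
    refine mem_of_superset this ?_
    rintro _ ⟨_, ⟨x, rfl⟩, rfl⟩
    exact ⟨affinePoint x, (hJ x).symm⟩
  have hopen : IsOpen (range j) := isOpen_iff_mem_nhds.2 <| by
    rintro _ ⟨z, rfl⟩
    obtain ⟨g, rfl⟩ := exists_moebius_eq (-1) z
    rw [hj]
    refine mem_of_superset ((Ψ g).isOpenMap.image_mem_nhds hnhds) ?_
    rintro _ ⟨_, ⟨x, rfl⟩, rfl⟩
    exact ⟨moebius g x, hj g x⟩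
  have hsurj : Surjective j := range_eq_univ.1 <|
    IsClopen.eq_univ ⟨(isCompact_range hc).isClosed, hopen⟩ (range_nonempty j)
  exact ⟨Continuous.homeoOfEquivCompactToT2 (f := Equiv.ofBijective j ⟨hinj, hsurj⟩) hc, hj⟩

/-! ### Regularity from regularity of all differences -/

/-- A family of `C¹` functions which depends continuously on a parameter is, by the Baire category
theorem, uniformly Lipschitz over some interval of parameters, so its integral over this
interval is again `C¹`. -/
theorem exists_interval_hasDerivAt_integral {H : ℝ → ℝ → ℝ} (hc : Continuous (uncurry H))
    (hd : ∀ θ, ContDiff ℝ 1 (H θ)) (hb : ∀ θ, ∃ M, ∀ y, |deriv (H θ) y| ≤ M) :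
    ∃ a b, a < b ∧ (∀ y, IntervalIntegrable (fun θ => deriv (H θ) y) MeasureTheory.volume a b ∧
      HasDerivAt (fun y => ∫ θ in a..b, H θ y) (∫ θ in a..b, deriv (H θ) y) y) ∧
      Continuous fun y => ∫ θ in a..b, deriv (H θ) y := by
  have hcθ : ∀ y, Continuous fun θ => H θ y := fun y =>
    hc.comp (continuous_id.prodMk continuous_const)
  let E : ℕ → Set ℝ := fun M => {θ | ∀ x y, |H θ x - H θ y| ≤ M * |x - y|}
  have hcl : ∀ M, IsClosed (E M) := fun M => by
    simp only [E, ofPred_forall]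
    exact isClosed_iInter fun x => isClosed_iInter fun y =>
      isClosed_le ((hcθ x).sub (hcθ y)).abs continuous_const
  have hcover : ⋃ M, E M = univ := eq_univ_of_forall fun θ => by
    obtain ⟨M, hM⟩ := hb θ
    obtain ⟨n, hn⟩ := exists_nat_ge M
    refine mem_iUnion.2 ⟨n, fun x y => ?_⟩
    have := (lipschitzWith_of_nnnorm_deriv_le (C := (n : NNReal))
      ((hd θ).differentiable one_ne_zero) fun y => by
        rw [← NNReal.coe_le_coe, coe_nnnorm, Real.norm_eq_abs]
        exact (hM y).trans (by simpa using hn)).dist_le_mul x y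
    simpa [Real.dist_eq] using this
  obtain ⟨M, θ₀, hθ₀⟩ := nonempty_interior_of_iUnion_of_closed hcl hcover
  obtain ⟨ε, hε, hball⟩ := Metric.mem_nhds_iff.1 (mem_interior_iff_mem_nhds.1 hθ₀)
  have hE : ∀ θ ∈ uIoc θ₀ (θ₀ + ε / 2), θ ∈ E M := fun θ hθ => by
    rw [uIoc_of_le (by linarith)] at hθ
    refine hball ?_
    rw [Metric.mem_ball, Real.dist_eq, abs_lt]
    exact ⟨by linarith [hθ.1], by linarith [hθ.2]⟩
  have hbound : ∀ θ ∈ uIoc θ₀ (θ₀ + ε / 2), ∀ y, ‖deriv (H θ) y‖ ≤ M := fun θ hθ y =>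
    norm_deriv_le_of_lip' (Nat.cast_nonneg M) (Eventually.of_forall fun x => hE θ hθ x y)
  have hmeas : ∀ y, Measurable fun θ => deriv (H θ) y := fun y =>
    (measurable_deriv_with_param hc).comp (measurable_id.prodMk measurable_const)
  refine ⟨θ₀, θ₀ + ε / 2, by linarith, fun y => ?_, ?_⟩
  · exact intervalIntegral.hasDerivAt_integral_of_dominated_loc_of_deriv_le
      (F := fun y θ => H θ y) (F' := fun y θ => deriv (H θ) y) (bound := fun _ => M) univ_mem
      (Eventually.of_forall fun y => (hcθ y).aestronglyMeasurable)
      ((hcθ y).intervalIntegrable _ _) (hmeas y).aestronglyMeasurable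
      (Eventually.of_forall fun θ hθ y _ => hbound θ hθ y) intervalIntegrable_const
      (Eventually.of_forall fun θ _ y _ =>
        ((hd θ).differentiable one_ne_zero y).hasDerivAt)
  · exact intervalIntegral.continuous_of_dominated_interval (bound := fun _ => M)
      (fun y => (hmeas y).aestronglyMeasurable)
      (fun y => Eventually.of_forall fun θ hθ => hbound θ hθ y) intervalIntegrable_const
      (Eventually.of_forall fun θ _ => (hd θ).continuous_deriv le_rfl)

theorem hasDerivAt_integral_add {f : ℝ → ℝ} (hf : Continuous f) (a b s : ℝ) :
    HasDerivAt (fun s => ∫ θ in a..b, f (s + θ)) (f (s + b) - f (s + a)) s := by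
  have hi : ∀ c d, IntervalIntegrable f MeasureTheory.volume c d := fun c d =>
    hf.intervalIntegrable c d
  have hprim : ∀ c, HasDerivAt (fun s => ∫ θ in (0 : ℝ)..(s + c), f θ) (f (s + c)) s := fun c => by
    have h1 := intervalIntegral.integral_hasDerivAt_right (hi 0 (s + c))
      hf.stronglyMeasurable.stronglyMeasurableAtFilter hf.continuousAt
    simpa using h1.comp_add_const s c
  refine ((hprim b).sub (hprim a)).congr_of_eventuallyEq (Eventually.of_forall fun s => ?_)
  simp only [Pi.sub_apply]
  rw [intervalIntegral.integral_comp_add_left f s,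
    intervalIntegral.integral_interval_sub_left (hi _ _) (hi _ _)]

theorem periodic_deriv {f : ℝ → ℝ} {c d : ℝ} (h : ∀ t, f (t + c) = f t + d) :
    Periodic (deriv f) c := fun t => by
  rw [← deriv_comp_add_const, funext h, deriv_add_const]

theorem exists_abs_le_of_periodic {f : ℝ → ℝ} (hf : Continuous f) (hp : Periodic f 1) :
    ∃ M, ∀ y, |f y| ≤ M := by
  obtain ⟨M, hM⟩ := (hp.isBounded_of_continuous one_ne_zero hf).exists_norm_le
  exact ⟨M, fun y => hM _ ⟨y, rfl⟩⟩

theorem contDiff_one_of_hasDerivAt {f f' : ℝ → ℝ} (h : ∀ x, HasDerivAt f (f' x) x)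
    (hc : Continuous f') : ContDiff ℝ 1 f := by
  rw [contDiff_one_iff_deriv]
  exact ⟨fun x => (h x).differentiableAt, by rwa [funext fun x => (h x).deriv]⟩

/-- If all differences `ψ (· + θ) - ψ` of a continuous periodic function are `C¹`, so is `ψ`. -/
theorem contDiff_one_of_differences {ψ : ℝ → ℝ} (hc : Continuous ψ) (hp : Periodic ψ 1)
    (h : ∀ θ, ContDiff ℝ 1 fun y => ψ (y + θ) - ψ y) : ContDiff ℝ 1 ψ := by
  obtain ⟨a, b, hab, hder, hcont⟩ := exists_interval_hasDerivAt_integral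
    (H := fun θ y => ψ (y + θ) - ψ y) (by fun_prop) h (fun θ =>
      exists_abs_le_of_periodic ((h θ).continuous_deriv le_rfl) (periodic_deriv (d := 0) fun t => by
        rw [add_right_comm, hp, hp, add_zero]))
  have h1 := contDiff_one_of_hasDerivAt (fun y => (hder y).2) hcont
  have h2 := contDiff_one_of_hasDerivAt (hasDerivAt_integral_add hc a b) (by fun_prop)
  have h3 : ψ = fun y => (b - a)⁻¹ *
      ((∫ θ in a..b, ψ (y + θ)) - ∫ θ in a..b, (ψ (y + θ) - ψ y)) := funext fun y => by
    rw [intervalIntegral.integral_sub (Continuous.intervalIntegrable (by fun_prop) _ _)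
      intervalIntegrable_const, sub_sub_cancel, intervalIntegral.integral_const, smul_eq_mul,
      inv_mul_cancel_left₀ (sub_pos.2 hab).ne']
  rw [h3]
  exact contDiff_const.mul (h2.sub h1)

/-- If all differences `ψ (· + θ) - ψ` of a continuous periodic function are `Cⁿ`, so is `ψ`. -/
theorem contDiff_of_differences (n : ℕ) {ψ : ℝ → ℝ} (hc : Continuous ψ) (hp : Periodic ψ 1)
    (h : ∀ θ, ContDiff ℝ n fun y => ψ (y + θ) - ψ y) : ContDiff ℝ n ψ := by
  induction n generalizing ψ with
  | zero => exact contDiff_zero.2 hc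
  | succ n ih =>
    have h1 : ContDiff ℝ 1 ψ := contDiff_one_of_differences hc hp fun θ =>
      (h θ).of_le (by exact_mod_cast Nat.le_add_left 1 n)
    have hd := h1.differentiable one_ne_zero
    push_cast at h ⊢
    refine contDiff_succ_iff_deriv.2 ⟨hd, by simp, ?_⟩
    refine ih (h1.continuous_deriv le_rfl) (periodic_deriv (d := 0) fun t => by
      rw [hp, add_zero]) fun θ => ?_
    have := (contDiff_succ_iff_deriv.1 (h θ)).2.2
    rwa [show (deriv fun y => ψ (y + θ) - ψ y) = fun y => deriv ψ (y + θ) - deriv ψ y from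
      funext fun y => by
        rw [deriv_fun_sub (by fun_prop) (by fun_prop), deriv_comp_add_const]] at this

/-- A continuous solution `u` of `G ∘ u = K` is `Cⁿ` where `G` and `K` are, and `G' ≠ 0`. -/
theorem contDiff_of_comp_eq {n : ℕ∞ω} (hn : n ≠ 0) {u G K : ℝ → ℝ} (hu : Continuous u)
    (hG : ContDiff ℝ n G) (hK : ContDiff ℝ n K) (hG' : ∀ x, deriv G x ≠ 0)
    (h : ∀ t, G (u t) = K t) : ContDiff ℝ n u := by
  refine contDiff_iff_contDiffAt.2 fun t => ?_
  have hder := ((hG.differentiable hn (u t)).hasDerivAt).hasFDerivAt_equiv (hG' (u t))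
  have hinv := (hG.contDiffAt (x := u t)).to_localInverse hder hn
  rw [h t] at hinv
  refine (hinv.comp t hK.contDiffAt).congr_of_eventuallyEq ?_
  have hev := ((hG.contDiffAt (x := u t)).hasStrictFDerivAt' hder hn).eventually_left_inverse
  filter_upwards [hu.continuousAt.eventually hev] with s hs
  rw [comp_apply, ← h s]
  exact hs.symm

/-! ### Regularity of a conjugacy to rotations -/

theorem deriv_conj_translation_pos {J : ℝ ≃o ℝ}
    (hF : ∀ θ, Differentiable ℝ fun y => J (J.symm y + θ)) (θ y : ℝ) :
    0 < deriv (fun y => J (J.symm y + θ)) y := by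
  have hmono : Monotone fun y => J (J.symm y + θ) := fun x y h =>
    J.monotone (add_le_add_left (J.symm.monotone h) θ)
  refine lt_of_le_of_ne hmono.deriv_nonneg fun h0 => ?_
  -- the translations by `θ` and `-θ` are conjugated to mutually inverse maps
  have h1 := (hF (-θ) (J (J.symm y + θ))).hasDerivAt.comp y (hF θ y).hasDerivAt
  rw [← h0, mul_zero] at h1
  have h2 : HasDerivAt (fun y : ℝ => y) 0 y := h1.congr_of_eventuallyEq
    (Eventually.of_forall fun y => by simp)
  exact one_ne_zero ((hasDerivAt_id y).unique h2)

/-- A conjugacy `J` between rotations and a flow of `C¹` diffeomorphisms is a `C¹` diffeomorphism: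
averaging `J (J⁻¹ y + θ)` over an interval of `θ` gives a `C¹` function `G` of `y`, and
`G (J s)` is a `C¹` function of `s`, as an average of `J`. -/
theorem contDiff_one_conj {J : ℝ ≃o ℝ} (hJ1 : ∀ t, J (t + 1) = J t + 1)
    (hF : ∀ θ, ContDiff ℝ 1 fun y => J (J.symm y + θ)) :
    ContDiff ℝ 1 J ∧ ∀ t, deriv J t ≠ 0 := by
  have hJc : Continuous J := J.continuous
  have hJs : Continuous J.symm := J.symm.continuous
  have hsymm : ∀ y, J.symm (y + 1) = J.symm y + 1 := fun y =>
    J.injective (by rw [J.apply_symm_apply, hJ1, J.apply_symm_apply])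
  have hpos := deriv_conj_translation_pos fun θ => (hF θ).differentiable one_ne_zero
  obtain ⟨a, b, hab, hder, hcont⟩ := exists_interval_hasDerivAt_integral
    (H := fun θ y => J (J.symm y + θ)) (by fun_prop) hF (fun θ =>
      exists_abs_le_of_periodic ((hF θ).continuous_deriv le_rfl) (periodic_deriv (d := 1) fun t => by
        rw [hsymm, add_right_comm, hJ1]))
  have hG := contDiff_one_of_hasDerivAt (fun y => (hder y).2) hcont
  have hKder := hasDerivAt_integral_add hJc a b
  have hK := contDiff_one_of_hasDerivAt hKder (by fun_prop)
  have hG' : ∀ y, deriv (fun y => ∫ θ in a..b, J (J.symm y + θ)) y ≠ 0 := fun y => by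
    rw [(hder y).2.deriv]
    exact (intervalIntegral.intervalIntegral_pos_of_pos_on (hder y).1
      (fun θ _ => hpos θ y) hab).ne'
  have heq : ∀ t, (fun y => ∫ θ in a..b, J (J.symm y + θ)) (J t) = ∫ θ in a..b, J (t + θ) :=
    fun t => by simp
  have hJ := contDiff_of_comp_eq one_ne_zero hJc hG hK hG' heq
  refine ⟨hJ, fun t h0 => ?_⟩
  have h1 := (hder (J t)).2.comp t (hJ.differentiable one_ne_zero t).hasDerivAt
  rw [h0, mul_zero] at h1
  have h2 := (h1.congr_of_eventuallyEq (Eventually.of_forall fun t => (heq t).symm)).unique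
    (hKder t)
  have h3 : J (t + a) < J (t + b) := J.strictMono (by linarith)
  linarith

/-- A conjugacy `J` between rotations and a flow of `Cⁿ` diffeomorphisms is `Cⁿ`. The differences
of `log J'` are `log` of the derivatives of the flow along `J`, and so gain regularity as long as
`J` is of class less than `Cⁿ`. -/
theorem contDiff_conj {J : ℝ ≃o ℝ} (hJ1 : ∀ t, J (t + 1) = J t + 1) {n : ℕ} (hn : n ≠ 0)
    (hF : ∀ θ, ContDiff ℝ n fun y => J (J.symm y + θ)) : ContDiff ℝ n J := by
  have hF1 : ∀ θ, ContDiff ℝ 1 fun y => J (J.symm y + θ) := fun θ =>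
    (hF θ).of_le (by exact_mod_cast Nat.one_le_iff_ne_zero.2 hn)
  have hFd : ∀ θ, Differentiable ℝ fun y => J (J.symm y + θ) := fun θ =>
    (hF1 θ).differentiable one_ne_zero
  have hpos := deriv_conj_translation_pos hFd
  obtain ⟨h1, hJ'⟩ := contDiff_one_conj hJ1 hF1
  have hJd := h1.differentiable one_ne_zero
  have hJc' := h1.continuous_deriv le_rfl
  have hJpos : ∀ t, 0 < deriv J t := fun t =>
    lt_of_le_of_ne J.monotone.deriv_nonneg (hJ' t).symm
  have hlog : ∀ θ t, Real.log (deriv J (t + θ)) - Real.log (deriv J t) =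
      Real.log (deriv (fun y => J (J.symm y + θ)) (J t)) := fun θ t => by
    have e1 := (hFd θ (J t)).hasDerivAt.comp t (hJd t).hasDerivAt
    have e2 : HasDerivAt (fun t => J (t + θ)) (deriv J (t + θ)) t :=
      (hJd (t + θ)).hasDerivAt.comp_add_const t θ
    rw [e2.unique (e1.congr_of_eventuallyEq (Eventually.of_forall fun t => by simp)),
      Real.log_mul (hpos θ _).ne' (hJ' t), add_sub_cancel_right]
  have key : ∀ k : ℕ, k ≠ 0 → k ≤ n → ContDiff ℝ k J := fun k hk => by
    induction k, Nat.one_le_iff_ne_zero.2 hk using Nat.le_induction with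
    | base => exact fun _ => by exact_mod_cast h1
    | succ k hk1 ih =>
      intro hkn
      have hJk := ih (by omega) (by omega)
      have hdiff : ∀ θ, ContDiff ℝ k fun t =>
          Real.log (deriv J (t + θ)) - Real.log (deriv J t) := fun θ => by
        simp only [hlog θ]
        have hF' : ContDiff ℝ k (deriv fun y => J (J.symm y + θ)) := by
          have := (hF θ).of_le (m := ((k + 1 : ℕ) : ℕ∞ω)) (by exact_mod_cast hkn)
          push_cast at this
          exact (contDiff_succ_iff_deriv.1 this).2.2
        exact (hF'.comp hJk).log fun t => (hpos θ _).ne'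
      have hl := contDiff_of_differences k (ψ := fun t => Real.log (deriv J t))
        (hJc'.log hJ') (fun t => by
          change Real.log (deriv J (t + 1)) = _
          rw [periodic_deriv hJ1 t]) hdiff
      push_cast
      refine contDiff_succ_iff_deriv.2 ⟨hJd, by simp, ?_⟩
      rw [show deriv J = fun t => Real.exp (Real.log (deriv J t)) from
        funext fun t => (Real.exp_log (hJpos t)).symm]
      exact hl.exp
  exact key n hn le_rfl

/-! ### Regularity of circle maps in terms of their lifts -/

theorem contMDiff_circ (n : ℕ∞ω) : ContMDiff 𝓘(ℝ, ℝ) (𝓡 1) n circ :=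
  contMDiff_circleExp.comp (contDiff_const.mul contDiff_id).contMDiff

/-- A section of `circ` through `t₀` which is smooth near `circ t₀`. -/
theorem exists_section_circ (n : ℕ∞ω) (t₀ : ℝ) : ∃ s : Circle → ℝ,
    ContMDiffAt (𝓡 1) 𝓘(ℝ, ℝ) n s (circ t₀) ∧ s (circ t₀) = t₀ ∧ ∀ z, circ (s z) = z := by
  have : Fact (Module.finrank ℝ ℂ = 1 + 1) := finrank_real_complex_fact'
  refine ⟨fun z => t₀ + (Complex.log ((z : ℂ) / circ t₀)).im / (2 * Real.pi), ?_, ?_, fun z => ?_⟩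
  · have hc : ContMDiff (𝓡 1) 𝓘(ℝ, ℂ) n (fun z : Circle => (z : ℂ)) := contMDiff_coe_sphere
    have hd : ContDiffAt ℂ n (fun w : ℂ => Complex.log (w / circ t₀)) (circ t₀ : ℂ) := by
      refine ContDiffAt.comp (g := Complex.log) _ (Complex.contDiffAt_log ?_)
        (contDiffAt_id.div_const _)
      rw [div_self (circ t₀).coe_ne_zero]
      exact Complex.one_mem_slitPlane
    have hd' : ContDiffAt ℝ n
        (fun w : ℂ => t₀ + (Complex.log (w / circ t₀)).im / (2 * Real.pi)) (circ t₀ : ℂ) :=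
      contDiffAt_const.add
        ((Complex.imCLM.contDiff.contDiffAt.comp _ (hd.restrict_scalars ℝ)).div_const _)
    exact ContMDiffAt.comp (I' := 𝓘(ℝ, ℂ)) (f := fun z : Circle => (z : ℂ))
      (g := fun w : ℂ => t₀ + (Complex.log (w / circ t₀)).im / (2 * Real.pi))
      (circ t₀) hd'.contMDiffAt (hc _)
  · simp
  · rw [circ_add, ← Circle.coe_div, Complex.log_im, circ,
      circ, mul_div_cancel₀ _ Real.two_pi_pos.ne', Circle.exp_arg]
    exact mul_div_cancel _ _

theorem IsLift.contDiff {F : ℝ → ℝ} {f : Circle → Circle} (hF : IsLift F f) {n : ℕ∞ω}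
    (hf : ContMDiff (𝓡 1) (𝓡 1) n f) : ContDiff ℝ n F := by
  rw [← contMDiff_iff_contDiff]
  intro t₀
  obtain ⟨s, hs, hs0, hsc⟩ := exists_section_circ n (F t₀)
  have hf' : ContMDiffAt 𝓘(ℝ, ℝ) (𝓡 1) n (fun t => f (circ t)) t₀ :=
    (hf.comp (contMDiff_circ n)) t₀
  rw [hF.circ_apply] at hs hs0
  have h1 : ContMDiffAt 𝓘(ℝ, ℝ) 𝓘(ℝ, ℝ) n (fun t => s (f (circ t))) t₀ := hs.comp t₀ hf'
  refine h1.congr_of_eventuallyEq ?_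
  have h2 : ContinuousAt (fun t => F t - s (f (circ t))) t₀ :=
    hF.continuous.continuousAt.sub h1.continuousAt
  -- both lifts differ by an integer, which is small near `t₀`
  filter_upwards [h2.eventually (Metric.ball_mem_nhds _ one_pos)] with t ht
  obtain ⟨m, hm⟩ := circ_eq_iff.1 ((hF.circ_apply t).trans (hsc _).symm)
  rw [hs0, sub_self, Real.dist_eq, sub_zero, hm, add_sub_cancel_left] at ht
  have hm0 : m = 0 := Int.abs_lt_one_iff.1 (by exact_mod_cast ht)
  simpa [hm0] using hm

theorem IsLift.contMDiff {F : ℝ → ℝ} {f : Circle → Circle} (hF : IsLift F f) {n : ℕ∞ω}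
    (hd : ContDiff ℝ n F) : ContMDiff (𝓡 1) (𝓡 1) n f := by
  intro z
  obtain ⟨t₀, rfl⟩ := circ_surjective z
  obtain ⟨s, hs, -, hsc⟩ := exists_section_circ n t₀
  have h1 : ContMDiffAt (𝓡 1) (𝓡 1) n (fun z => circ (F (s z))) (circ t₀) :=
    (((contMDiff_circ n).comp hd.contMDiff) _).comp _ hs
  refine h1.congr_of_eventuallyEq (Eventually.of_forall fun z => ?_)
  simp only [hF.circ_apply, hsc]

theorem circ_neg (t : ℝ) : circ (-t) = (circ t)⁻¹ :=
  eq_inv_of_mul_eq_one_left (by rw [← circ_add, neg_add_cancel, circ_zero])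

/-- An increasing homeomorphism which conjugates all rotations to `Cᵖ` maps is a `Cᵖ`
diffeomorphism. -/
theorem contMDiff_of_conj_rotations_of_strictMono {p : ℕ∞} (hp : p ≠ 0) {j : Circle ≃ₜ Circle}
    {J : ℝ → ℝ} (hJ : IsLift J j) (hm : StrictMono J) (hJ1 : ∀ t, J (t + 1) = J t + 1)
    (h : ∀ θ, ContMDiff (𝓡 1) (𝓡 1) p fun z => j (circ θ * j.symm z)) :
    ContMDiff (𝓡 1) (𝓡 1) p j ∧ ContMDiff (𝓡 1) (𝓡 1) p j.symm := by
  let L : CircleDeg1Lift := ⟨⟨J, hm.monotone⟩, hJ1⟩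
  have hsurj : Surjective J := hJ.continuous.surjective L.tendsto_atTop L.tendsto_atBot
  let I : ℝ ≃o ℝ := hm.orderIsoOfSurjective J hsurj
  have hI : ⇑I = J := rfl
  have hsymm : IsLift I.symm j.symm := ⟨I.symm.continuous, fun t => by
    rw [eq_comm, Homeomorph.symm_apply_eq, ← hJ.circ_apply, ← hI, I.apply_symm_apply]⟩
  have hF : ∀ θ, ContDiff ℝ p fun y => I (I.symm y + θ) := fun θ => by
    refine IsLift.contDiff ⟨by fun_prop, fun t => ?_⟩ (h θ)
    rw [hI, hJ.circ_apply, circ_add, hsymm.circ_apply, mul_comm]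
  have hI1 : ∀ t, I (t + 1) = I t + 1 := hJ1
  have hd : ContDiff ℝ p I := contDiff_iff_forall_nat_le.2 fun m hm => by
    rcases eq_or_ne m 0 with rfl | hm0
    · exact contDiff_zero.2 I.continuous
    · exact contDiff_conj hI1 hm0 fun θ => (hF θ).of_le (by exact_mod_cast hm)
  have hp1 : (1 : ℕ∞ω) ≤ p := by exact_mod_cast Order.one_le_iff_ne_zero.2 hp
  have hne : ∀ t, deriv I t ≠ 0 := (contDiff_one_conj hI1 fun θ => (hF θ).of_le hp1).2
  have hp0 : (p : ℕ∞ω) ≠ 0 := by exact_mod_cast hp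
  exact ⟨hJ.contMDiff hd, hsymm.contMDiff
    (contDiff_of_comp_eq hp0 I.symm.continuous hd contDiff_id hne I.apply_symm_apply)⟩

theorem contMDiff_inv_circle (n : ℕ∞ω) : ContMDiff (𝓡 1) (𝓡 1) n fun z : Circle => z⁻¹ :=
  IsLift.contMDiff (F := fun t => -t) ⟨continuous_neg, circ_neg⟩ contDiff_neg

/-- A homeomorphism which conjugates all rotations to `Cᵖ` maps is a `Cᵖ` diffeomorphism. -/
theorem contMDiff_of_conj_rotations {p : ℕ∞} {j : Circle ≃ₜ Circle}
    (h : ∀ θ, ContMDiff (𝓡 1) (𝓡 1) p fun z => j (circ θ * j.symm z)) :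
    ContMDiff (𝓡 1) (𝓡 1) p j ∧ ContMDiff (𝓡 1) (𝓡 1) p j.symm := by
  rcases eq_or_ne p 0 with rfl | hp
  · exact ⟨contMDiff_zero_iff.2 j.continuous, contMDiff_zero_iff.2 j.symm.continuous⟩
  obtain ⟨J, hJ⟩ := exists_isLift j.continuous
  rcases hJ.strictMono_or_strictAnti with ⟨hm, hJ1⟩ | ⟨hm, hJ1⟩
  · exact contMDiff_of_conj_rotations_of_strictMono hp hJ hm hJ1 h
  · -- a decreasing conjugacy becomes increasing after composition with `z ↦ z⁻¹`
    let k : Circle ≃ₜ Circle := (Homeomorph.inv Circle).trans j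
    have hk : IsLift (fun t => J (-t)) k := ⟨hJ.continuous.comp continuous_neg, fun t => by
      rw [hJ.circ_apply, circ_neg]; rfl⟩
    obtain ⟨h1, h2⟩ := contMDiff_of_conj_rotations_of_strictMono hp hk
      (fun s t hst => hm (neg_lt_neg hst))
      (fun t => by
        have := hJ1 (-(t + 1))
        rw [show -(t + 1) + 1 = -t by ring] at this
        linarith)
      (fun θ => by
        have hθ : (fun z => k (circ θ * k.symm z)) = fun z => j (circ (-θ) * j.symm z) :=
          funext fun z => by
            change j (circ θ * (j.symm z)⁻¹)⁻¹ = _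
            rw [circ_neg, mul_inv, inv_inv]
        rw [hθ]
        exact h (-θ))
    have e1 : (j : Circle → Circle) = k ∘ fun z => z⁻¹ := funext fun z => by
      change j z = j (z⁻¹)⁻¹
      rw [inv_inv]
    have e2 : (j.symm : Circle → Circle) = (fun z => z⁻¹) ∘ k.symm := funext fun z => by
      change j.symm z = ((j.symm z)⁻¹)⁻¹
      rw [inv_inv]
    rw [e1, e2]
    exact ⟨h1.comp (contMDiff_inv_circle _), (contMDiff_inv_circle _).comp h2⟩

/-- The inclusion of `Diff^p(S¹)` into the homeomorphism group of the circle. -/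
def toHomeomorphHom (p : ℕ∞) : Diff p →* (Circle ≃ₜ Circle) where
  toFun f := f.toHomeomorph
  map_one' := rfl
  map_mul' _ _ := rfl

theorem neg_one_mem_center : (-1 : SL(2, ℝ)) ∈ Subgroup.center SL(2, ℝ) :=
  Subgroup.mem_center_iff.2 fun g => by rw [mul_neg, neg_mul, mul_one, one_mul]

end CircleDiff

end

/-- Every nontrivial (abstract) homomorphism `PSL(2,ℝ) → Diff^p(S¹)`, `p ∈ {0, 2, 3, …, ∞}`, is the
conjugate of the standard inclusion by a `C^p` diffeomorphism of the circle. -/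
theorem theorem4 (p : ℕ∞) (hp : p ≠ 1) (Φ : PSL(2, ℝ) →* CircleDiff.Diff p) (hΦ : ∃ g, Φ g ≠ 1) :
    ∃ h : CircleDiff.Diff p, ∀ g : PSL(2, ℝ),
      Φ g = h * CircleDiff.standardInclusion p g * h⁻¹ := by
  let Ψ : SL(2, ℝ) →* (Circle ≃ₜ Circle) := (CircleDiff.toHomeomorphHom p).comp
    (Φ.comp (QuotientGroup.mk' (Subgroup.center SL(2, ℝ))))
  have hΨ : ∀ (g : SL(2, ℝ)) z, Ψ g z = Φ (g : PSL(2, ℝ)) z := fun _ _ => rfl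
  have hneg : Ψ (-1) = 1 := by
    have h1 : ((-1 : SL(2, ℝ)) : PSL(2, ℝ)) = 1 :=
      (QuotientGroup.eq_one_iff _).2 CircleDiff.neg_one_mem_center
    ext1 z
    rw [hΨ, h1, map_one]
    rfl
  have hnt : Ψ ≠ 1 := fun h => by
    obtain ⟨g, hg⟩ := hΦ
    obtain ⟨g, rfl⟩ := QuotientGroup.mk_surjective g
    refine hg (Diffeomorph.ext fun z => ?_)
    have := hΨ g z
    rw [h] at this
    exact this.symm
  obtain ⟨j, hj⟩ := CircleDiff.exists_topological_conjugacy hneg hnt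
  have hreg := CircleDiff.contMDiff_of_conj_rotations (p := p) (j := j) fun θ => by
    have e : (fun z => j (CircleDiff.circ θ * j.symm z)) =
        Φ (CircleDiff.rotation (Real.pi * θ) : PSL(2, ℝ)) := funext fun z => by
      rw [← hΨ, ← j.apply_symm_apply z, ← hj, CircleDiff.moebius_rotation,
        mul_div_cancel_left₀ _ Real.pi_pos.ne', j.symm_apply_apply]
    rw [e]
    exact (Φ _).contMDiff_toFun
  let h : CircleDiff.Diff p := ⟨j.toEquiv, hreg.1, hreg.2⟩
  refine ⟨h, fun g => ?_⟩
  rw [eq_mul_inv_iff_mul_eq]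
  obtain ⟨g, rfl⟩ := QuotientGroup.mk_surjective g
  refine Diffeomorph.ext fun z => ?_
  rw [CircleDiff.Diff.mul_apply, CircleDiff.Diff.mul_apply, CircleDiff.standardInclusion_mk, ← hΨ]
  exact (hj g z).symm
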